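/- Let $R$ be a commutative Noetherian ring of finite Krull dimension $d \ge 1$. An $R$-module $L$ is called minimax if it has a finitely generated submodule $N$ such that $L/N$ is Artinian. For an ideal $\mathfrak a$ of $R$ let $V(\mathfrak a)$ be the set of prime ideals containing $\mathfrak a$; an $R$-module $M$ (not necessarily finitely generated) is called $\mathfrak a$-cominimax if $\operatorname{Supp}_R M \subseteq V(\mathfrak a)$ and $\operatorname{Ext}^i_R(R/\mathfrak a, M)$ is minimax for all $i \ge 0$. For an integer $n\ge 0$, we say that $R$ admits $P'_n(\mathfrak a)$ if every $R$-module $M$ such that $\operatorname{Supp}_R M \subseteq V(\mathfrak a)$ and $\operatorname{Ext}^i_R(R/\mathfrak a, M)$ is minimax for all $0\le i \le n$ is $\mathfrak a$-cominimax. Suppose that $R$ admits $P'_{d-1}(\mathfrak a)$ for every ideal $\mathfrak a$ of $R$ with $\dim R/\mathfrak a \le d-1$. Then $R$ admits $P'_{d-1}(\mathfrak a)$ for every ideal $\mathfrak a$ of $R$. -/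

import Mathlib

universe u

/-- An `R`-module `M` is *minimax* if it has a finitely generated submodule `N` such that
`M ⧸ N` is Artinian. -/
def IsMinimax (R : Type*) [CommRing R] (M : Type*) [AddCommGroup M] [Module R M] : Prop :=
  ∃ N : Submodule R M, N.FG ∧ IsArtinian R (M ⧸ N)

/-- The `R`-module `Ext^i_R(R ⧸ a, M)`. -/
abbrev ExtQuotient {R : Type u} [CommRing R] (a : Ideal R) (M : Type u) [AddCommGroup M]
    [Module R M] (i : ℕ) : Type u :=
  CategoryTheory.Abelian.Ext.{u} (ModuleCat.of R (R ⧸ a)) (ModuleCat.of R M) i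

/-- An `R`-module `M` is *`a`-cominimax* if `Supp M ⊆ V(a)` and `Ext^i_R(R ⧸ a, M)` is minimax
for all `i ≥ 0`. -/
def IsCominimax {R : Type u} [CommRing R] (a : Ideal R) (M : Type u) [AddCommGroup M]
    [Module R M] : Prop :=
  Module.support R M ⊆ PrimeSpectrum.zeroLocus (a : Set R) ∧
    ∀ i : ℕ, IsMinimax R (ExtQuotient a M i)

/-- `R` admits the condition `P'_n(a)`: every `R`-module `M` with `Supp M ⊆ V(a)` for which
`Ext^i_R(R ⧸ a, M)` is minimax for all `i ≤ n` is `a`-cominimax. -/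
def AdmitsP' {R : Type u} [CommRing R] (n : ℕ) (a : Ideal R) : Prop :=
  ∀ (M : Type u) [AddCommGroup M] [Module R M],
    Module.support R M ⊆ PrimeSpectrum.zeroLocus (a : Set R) →
    (∀ i : ℕ, i ≤ n → IsMinimax R (ExtQuotient a M i)) →
    IsCominimax a M

open CategoryTheory Abelian

/-! ### Minimax modules form a Serre class. -/

section Minimax

variable {R : Type*} [CommRing R]
variable {A : Type*} [AddCommGroup A] [Module R A]
variable {B : Type*} [AddCommGroup B] [Module R B]
variable {C : Type*} [AddCommGroup C] [Module R C]

/-! The problem for `a` is moved to the larger ideal `a + c`, where `c = (0 : a^t)` and `t` is so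
large that the ascending chain of annihilators `(0 : a^k)` has stabilized. No minimal prime `p`
contains `a + c`: if `a ≤ p`, then `a` is nilpotent in `R_p`, so some element outside `p` kills a
power of `a` and hence lies in `c`. Therefore `dim R/(a + c) ≤ d - 1`, and the hypothesis applies to
`a + c`.

To return to `a`, let `N = (0 :_M c)`. Then `M/N` embeds in `Hom(c, M)`, which is minimax because
`c` is finitely generated and killed by `a^t`. So `M` and `N` have the same `Ext(R/a, -)` up to
minimax modules, and `N` is supported in `V(a + c)`. It remains to pass, for `N` killed by `c`, from
minimax `Ext(R/(a + c), N)` to minimax `Ext(R/a, N)` (`isMinimax_ext_of_le_annihilator_of_sup`). -/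

theorem IsMinimax.of_surjective (hA : IsMinimax R A) (f : A →ₗ[R] B)
    (hf : Function.Surjective f) : IsMinimax R B := by
  obtain ⟨N, hN, hNA⟩ := hA
  refine ⟨N.map f, hN.map f, ?_⟩
  refine isArtinian_of_surjective _ (N.mapQ (N.map f) f (Submodule.le_comap_map f N)) fun y ↦ ?_
  obtain ⟨b, rfl⟩ := Submodule.mkQ_surjective _ y
  obtain ⟨a, rfl⟩ := hf b
  exact ⟨N.mkQ a, rfl⟩

theorem IsMinimax.of_injective [IsNoetherianRing R] (hB : IsMinimax R B) (f : A →ₗ[R] B)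
    (hf : Function.Injective f) : IsMinimax R A := by
  obtain ⟨N, hN, hNB⟩ := hB
  have : Module.Finite R N := Module.Finite.iff_fg.mpr hN
  refine ⟨N.comap f, ?_, ?_⟩
  · rw [← Module.Finite.iff_fg]
    exact Module.Finite.of_injective (f.restrict (p := N.comap f) (q := N) fun _ h ↦ h)
      fun x y h ↦ Subtype.ext (hf (congrArg Subtype.val h))
  · refine isArtinian_of_injective ((N.comap f).mapQ N f le_rfl) ?_
    rw [← LinearMap.ker_eq_bot, Submodule.mapQ, Submodule.ker_liftQ, LinearMap.ker_comp,
      Submodule.ker_mkQ, Submodule.mkQ_map_self]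

theorem IsMinimax.of_subsingleton [Subsingleton A] : IsMinimax R A :=
  ⟨⊥, Submodule.fg_bot, inferInstance⟩

theorem IsMinimax.of_submodule_of_quotient (N : Submodule R B) (hN : IsMinimax R N)
    (hQ : IsMinimax R (B ⧸ N)) : IsMinimax R B := by
  obtain ⟨P, hP, hPN⟩ := hN
  obtain ⟨Q, hQ, hQB⟩ := hQ
  obtain ⟨Q', hQ', rfl⟩ : ∃ Q' : Submodule R B, Q'.FG ∧ Q'.map N.mkQ = Q := by
    obtain ⟨s, rfl⟩ := hQ
    classical
    obtain ⟨t, rfl⟩ : ∃ t : Finset B, t.image N.mkQ = s :=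
      ⟨s.image Quotient.out, by ext; simp [Finset.mem_image]⟩
    exact ⟨Submodule.span R t, ⟨t, rfl⟩, by rw [Submodule.map_span, Finset.coe_image]⟩
  -- With this `S`, the sequence `N/P → B/S → (B/N)/Q` is exact in the middle, and its outer terms
  -- are Artinian.
  set S := P.map N.subtype ⊔ Q' with hS
  refine ⟨S, (hP.map _).sup hQ', ?_⟩
  let f : (N ⧸ P) →ₗ[R] B ⧸ S := P.mapQ S N.subtype
    (Submodule.map_le_iff_le_comap.mp le_sup_left)
  let g : (B ⧸ S) →ₗ[R] (B ⧸ N) ⧸ Q'.map N.mkQ := S.mapQ _ N.mkQ (by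
    rw [hS, sup_le_iff]
    refine ⟨?_, Submodule.le_comap_map _ _⟩
    rw [Submodule.map_le_iff_le_comap]
    intro x _
    have : N.mkQ x = 0 := by simp
    rw [Submodule.mem_comap, Submodule.mem_comap, Submodule.subtype_apply, this]
    exact zero_mem _)
  have hfg : LinearMap.ker g ≤ LinearMap.range f := by
    rintro x hx
    obtain ⟨b, rfl⟩ := Submodule.mkQ_surjective _ x
    have hb : N.mkQ b ∈ Q'.map N.mkQ := by simpa [g] using hx
    obtain ⟨q, hq, hqb⟩ := hb
    have hn : b - q ∈ N := by
      rw [← Submodule.Quotient.mk_eq_zero, Submodule.Quotient.mk_sub]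
      exact sub_eq_zero.mpr hqb.symm
    refine ⟨P.mkQ ⟨b - q, hn⟩, ?_⟩
    have : q ∈ S := Submodule.mem_sup_right hq
    simpa [f] using this
  have h1 : IsArtinian R (LinearMap.range f) :=
    isArtinian_of_surjective _ f.rangeRestrict f.surjective_rangeRestrict
  have h2 : IsArtinian R (LinearMap.ker g) :=
    isArtinian_of_injective (Submodule.inclusion hfg) (Submodule.inclusion_injective hfg)
  exact isArtinian_of_range_eq_ker (LinearMap.ker g).subtype g (by simp)

theorem IsMinimax.of_exact [IsNoetherianRing R] (hA : IsMinimax R A) (hC : IsMinimax R C)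
    (f : A →ₗ[R] B) (g : B →ₗ[R] C) (h : ∀ b, g b = 0 → ∃ a, f a = b) : IsMinimax R B := by
  have h1 : IsMinimax R (LinearMap.range f) :=
    hA.of_surjective f.rangeRestrict f.surjective_rangeRestrict
  have hle : LinearMap.ker g ≤ LinearMap.range f := fun b hb ↦ h b hb
  refine .of_submodule_of_quotient (LinearMap.ker g)
    (h1.of_injective _ (Submodule.inclusion_injective hle))
    (hC.of_injective ((LinearMap.ker g).liftQ g le_rfl) ?_)
  rw [← LinearMap.ker_eq_bot, Submodule.ker_liftQ_eq_bot]
  exact le_rfl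

end Minimax

/-! ### Minimal primes, dimension and annihilators of powers. -/

section Dimension

variable {R : Type*} [CommRing R]

/-- Every chain of primes in `V(I)` extends downwards by a minimal prime, which lies outside `V(I)`.
-/
theorem ringKrullDim_quotient_succ_le_of_forall_minimalPrimes (I : Ideal R)
    (h : ∀ p ∈ minimalPrimes R, ¬ I ≤ p) :
    ringKrullDim (R ⧸ I) + 1 ≤ ringKrullDim R := by
  by_cases hI : I = ⊤
  · have : Subsingleton (R ⧸ I) := Ideal.Quotient.subsingleton_iff.mpr hI
    rw [ringKrullDim_eq_bot_of_subsingleton]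
    simp
  have : Nonempty (PrimeSpectrum.zeroLocus (R := R) I) := by
    rwa [Set.nonempty_coe_sort, Set.nonempty_iff_ne_empty, ne_eq,
      PrimeSpectrum.zeroLocus_empty_iff_eq_top]
  have := Ideal.Quotient.nontrivial_iff.mpr hI
  have := (Ideal.Quotient.mk I).domain_nontrivial
  rw [ringKrullDim_quotient, Order.krullDim_eq_iSup_length, ringKrullDim,
    Order.krullDim_eq_iSup_length, ← WithBot.coe_one, ← WithBot.coe_add,
    ENat.iSup_add, WithBot.coe_le_coe, iSup_le_iff]
  intro l
  obtain ⟨p, hp, hp'⟩ := Ideal.exists_minimalPrimes_le (J := l.head.1.asIdeal) bot_le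
  let p' : PrimeSpectrum R := ⟨p, hp.1.1⟩
  have hp' : p' < l.head := lt_of_le_of_ne hp' fun e ↦ h p hp (by
    have := l.head.2
    rw [← e] at this
    exact this)
  let L : LTSeries (PrimeSpectrum R) := l.map Subtype.val (Subtype.strictMono_coe _)
  have hL : (RelSeries.cons L p' hp').length = l.length + 1 := RelSeries.cons_length L p' hp'
  have := le_iSup (fun l : LTSeries (PrimeSpectrum R) ↦ (l.length : ℕ∞)) (RelSeries.cons L p' hp')
  rw [hL] at this
  exact_mod_cast this

/-- The maximal ideal of `R_p` is nilpotent, so each element of some `a^k` is killed by an element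
outside `p`; multiplying these over finitely many generators of `a^k` gives a common one. -/
theorem exists_notMem_annihilator_pow_of_mem_minimalPrimes [IsNoetherianRing R] {p : Ideal R}
    (hp : p ∈ minimalPrimes R) {a : Ideal R} (hap : a ≤ p) :
    ∃ k : ℕ, ∃ s ∈ Submodule.annihilator (a ^ k), s ∉ p := by
  have : p.IsPrime := hp.1.1
  let A := Localization.AtPrime p
  have hrad := IsLocalization.AtPrime.radical_map_of_mem_minimalPrimes A p ⊥ hp
  obtain ⟨k, hk⟩ := Ideal.exists_radical_pow_le_of_fg ((⊥ : Ideal R).map (algebraMap R A))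
    (IsNoetherian.noetherian _)
  rw [hrad, ← Ideal.map_pow, Ideal.map_bot, le_bot_iff, Ideal.map_eq_bot_iff_le_ker] at hk
  have key : ∀ x ∈ a ^ k, ∃ s ∉ p, s * x = 0 := fun x hx ↦ by
    have : algebraMap R A x = 0 := hk (Ideal.pow_right_mono hap k hx)
    rw [IsLocalization.map_eq_zero_iff p.primeCompl A] at this
    obtain ⟨s, hs⟩ := this
    exact ⟨s, s.2, hs⟩
  refine ⟨k, ?_⟩
  have : ∀ J : Ideal R, J ≤ a ^ k → ∃ s ∈ Submodule.annihilator J, s ∉ p := fun J ↦ by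
    induction J, IsNoetherian.noetherian J using Submodule.fg_induction with
    | singleton x =>
      intro hx
      obtain ⟨s, hs, hsx⟩ := key x (hx (Submodule.mem_span_singleton_self x))
      exact ⟨s, by rwa [Submodule.mem_annihilator_span_singleton], hs⟩
    | sup J₁ J₂ _ _ h₁ h₂ =>
      intro hle
      obtain ⟨s, hs, hsp⟩ := h₁ (le_sup_left.trans hle)
      obtain ⟨t, ht, htp⟩ := h₂ (le_sup_right.trans hle)
      refine ⟨s * t, ?_, fun h ↦ (Ideal.IsPrime.mem_or_mem ‹_› h).elim hsp htp⟩
      rw [Submodule.annihilator_sup]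
      exact ⟨Ideal.mul_mem_right _ _ hs, Ideal.mul_mem_left _ _ ht⟩
  exact this _ le_rfl

theorem exists_forall_annihilator_pow_le [IsNoetherianRing R] (a : Ideal R) :
    ∃ t : ℕ, ∀ k, Submodule.annihilator (a ^ k) ≤ Submodule.annihilator (a ^ t) := by
  obtain ⟨t, ht⟩ := monotone_stabilizes_iff_noetherian.mpr ‹IsNoetherianRing R›
    ⟨fun k ↦ Submodule.annihilator (a ^ k),
      fun _ _ h ↦ Submodule.annihilator_mono (Ideal.pow_le_pow_right h)⟩
  refine ⟨t, fun k ↦ ?_⟩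
  have : Submodule.annihilator (a ^ t) = Submodule.annihilator (a ^ max t k) :=
    ht _ (le_max_left t k)
  rw [this]
  exact Submodule.annihilator_mono (Ideal.pow_le_pow_right (le_max_right t k))

end Dimension

/-! ### Minimax Ext modules and change of the first argument. -/

section Ext

variable {R : Type u} [CommRing R]

theorem isMinimax_ext_of_subsingleton (A : Type u) [AddCommGroup A] [Module R A] [Subsingleton A]
    (Y : ModuleCat.{u} R) (i : ℕ) : IsMinimax R (Ext.{u} (ModuleCat.of R A) Y i) := by
  have : Subsingleton (Ext.{u} (ModuleCat.of R A) Y i) := by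
    refine subsingleton_of_forall_eq 0 fun x ↦ ?_
    have h : (1 : R) • 𝟙 (ModuleCat.of R A) = 0 := by
      ext a
      exact Subsingleton.elim (α := A) _ _
    rw [one_smul] at h
    rw [← Ext.mk₀_id_comp x, h, Ext.mk₀_zero, Ext.zero_comp]
  exact .of_subsingleton

theorem shortExact_mkQ {A : Type u} [AddCommGroup A] [Module R A] (N : Submodule R A) :
    (ModuleCat.shortComplexOfCompEqZero N.subtype N.mkQ
      (LinearMap.exact_subtype_mkQ N).linearMap_comp_eq_zero).ShortExact :=
  ModuleCat.shortComplex_shortExact _ (LinearMap.exact_subtype_mkQ N) N.injective_subtype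
    N.mkQ_surjective

theorem exists_surjective_pi_quotient_of_le_annihilator {I : Ideal R} {A : Type*} [AddCommGroup A]
    [Module R A] [Module.Finite R A] (hA : I ≤ Module.annihilator R A) :
    ∃ (m : ℕ) (q : (Fin m → R ⧸ I) →ₗ[R] A), Function.Surjective q := by
  obtain ⟨m, s, hs⟩ := Module.Finite.exists_fin (R := R) (M := A)
  let q : (Fin m → R ⧸ I) →ₗ[R] A := LinearMap.lsum R (fun _ ↦ R ⧸ I) R fun j ↦
    Submodule.liftQ I (LinearMap.toSpanSingleton R A (s j)) fun r hr ↦ by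
      simpa using Module.mem_annihilator.mp (hA hr) (s j)
  refine ⟨m, q, ?_⟩
  rw [← LinearMap.range_eq_top, eq_top_iff, ← hs, Submodule.span_le]
  rintro _ ⟨j, rfl⟩
  refine ⟨Pi.single j (Submodule.Quotient.mk 1), ?_⟩
  rw [LinearMap.lsum_piSingle, Submodule.liftQ_apply]
  simp

theorem isMinimax_linearMap_of_isMinimax_ext {A : Type u} [AddCommGroup A] [Module R A]
    {L : Type u} [AddCommGroup L] [Module R L]
    (h : IsMinimax R (Ext.{u} (ModuleCat.of R A) (ModuleCat.of R L) 0)) :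
    IsMinimax R (A →ₗ[R] L) :=
  let e := (Ext.linearEquiv₀ (R := R) (X := ModuleCat.of R A) (Y := ModuleCat.of R L)).trans
    ModuleCat.homLinearEquiv
  h.of_surjective e.toLinearMap e.surjective

variable [IsNoetherianRing R]

section LongExactSequences

variable {S : ShortComplex (ModuleCat.{u} R)}

theorem isMinimax_ext_X₂_of_contravariant (hS : S.ShortExact)
    (Y : ModuleCat.{u} R) {i : ℕ} (h₁ : IsMinimax R (Ext.{u} S.X₁ Y i))
    (h₃ : IsMinimax R (Ext.{u} S.X₃ Y i)) : IsMinimax R (Ext.{u} S.X₂ Y i) :=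
  h₃.of_exact h₁ ((Ext.mk₀ S.g).precompOfLinear R Y (zero_add i))
    ((Ext.mk₀ S.f).precompOfLinear R Y (zero_add i))
    (Ext.contravariant_sequence_exact₂ hS Y)

theorem isMinimax_ext_X₃_succ_of_contravariant (hS : S.ShortExact)
    (Y : ModuleCat.{u} R) {i : ℕ} (h₁ : IsMinimax R (Ext.{u} S.X₁ Y i))
    (h₂ : IsMinimax R (Ext.{u} S.X₂ Y (i + 1))) : IsMinimax R (Ext.{u} S.X₃ Y (i + 1)) :=
  h₁.of_exact h₂ (hS.extClass.precompOfLinear R Y (add_comm 1 i))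
    ((Ext.mk₀ S.g).precompOfLinear R Y (zero_add (i + 1)))
    fun x hx ↦ Ext.contravariant_sequence_exact₃ hS Y x hx (add_comm 1 i)

theorem isMinimax_ext_X₃_zero_of_contravariant (hS : S.ShortExact)
    (Y : ModuleCat.{u} R) (h₂ : IsMinimax R (Ext.{u} S.X₂ Y 0)) :
    IsMinimax R (Ext.{u} S.X₃ Y 0) :=
  have := hS.epi_g
  h₂.of_injective ((Ext.mk₀ S.g).precompOfLinear R Y (zero_add 0))
    (Ext.precomp_mk₀_injective_of_epi Y S.g)

theorem isMinimax_ext_X₂_of_covariant (hS : S.ShortExact)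
    (Y : ModuleCat.{u} R) {i : ℕ} (h₁ : IsMinimax R (Ext.{u} Y S.X₁ i))
    (h₃ : IsMinimax R (Ext.{u} Y S.X₃ i)) : IsMinimax R (Ext.{u} Y S.X₂ i) :=
  h₁.of_exact h₃ ((Ext.mk₀ S.f).postcompOfLinear R Y (add_zero i))
    ((Ext.mk₀ S.g).postcompOfLinear R Y (add_zero i))
    (Ext.covariant_sequence_exact₂ Y hS)

theorem isMinimax_ext_X₁_of_covariant (hS : S.ShortExact)
    (Y : ModuleCat.{u} R) {n : ℕ} (h₂ : ∀ i ≤ n, IsMinimax R (Ext.{u} Y S.X₂ i))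
    (h₃ : ∀ i ≤ n, IsMinimax R (Ext.{u} Y S.X₃ i)) :
    ∀ i ≤ n, IsMinimax R (Ext.{u} Y S.X₁ i)
  | 0, _ =>
    have := hS.mono_f
    (h₂ 0 (Nat.zero_le n)).of_injective ((Ext.mk₀ S.f).postcompOfLinear R Y (add_zero 0))
      (Ext.postcomp_mk₀_injective_of_mono Y S.f)
  | i + 1, hi =>
    (h₃ i (by lia)).of_exact (h₂ (i + 1) hi) (hS.extClass.postcompOfLinear R Y rfl)
      ((Ext.mk₀ S.f).postcompOfLinear R Y (add_zero (i + 1)))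
      fun x hx ↦ Ext.covariant_sequence_exact₁ Y hS x hx rfl

end LongExactSequences

theorem isMinimax_ext_pi (P : Type u) [AddCommGroup P] [Module R P] (Y : ModuleCat.{u} R) {i : ℕ}
    (h : IsMinimax R (Ext.{u} (ModuleCat.of R P) Y i)) (m : ℕ) :
    IsMinimax R (Ext.{u} (ModuleCat.of R (Fin m → P)) Y i) := by
  induction m with
  | zero => exact isMinimax_ext_of_subsingleton _ Y i
  | succ m ih =>
    let f : P →ₗ[R] (Fin (m + 1) → P) := LinearMap.single R (fun _ ↦ P) 0
    let g : (Fin (m + 1) → P) →ₗ[R] (Fin m → P) := LinearMap.funLeft R P Fin.succ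
    have hg : Function.Surjective g :=
      LinearMap.funLeft_surjective_of_injective R P _ (Fin.succ_injective m)
    have hfg : Function.Exact f g := by
      intro x
      constructor
      · intro hx
        refine ⟨x 0, ?_⟩
        ext j
        refine Fin.cases ?_ (fun j ↦ ?_) j
        · simp [f]
        · simpa [f, g, LinearMap.funLeft] using (congrFun hx j).symm
      · rintro ⟨y, rfl⟩
        ext j
        simp [f, g, LinearMap.funLeft]
    have hS := ModuleCat.shortComplex_shortExact
      (ModuleCat.shortComplexOfCompEqZero f g hfg.linearMap_comp_eq_zero) hfg
      (Pi.single_injective (M := fun _ ↦ P) 0) hg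
    exact isMinimax_ext_X₂_of_contravariant hS Y h ih

/-- If `Ext^i(R ⧸ I, Y)` is minimax for `i ≤ n`, then so is `Ext^i(A, Y)` for every finitely
generated module `A` annihilated by a power of `I`. -/
theorem isMinimax_ext_of_pow_le_annihilator (I : Ideal R) (Y : ModuleCat.{u} R) {n : ℕ}
    (h : ∀ i ≤ n, IsMinimax R (Ext.{u} (ModuleCat.of R (R ⧸ I)) Y i)) (i : ℕ) (hi : i ≤ n)
    (A : Type u) [AddCommGroup A] [Module R A] [Module.Finite R A] (k : ℕ)
    (hA : I ^ k ≤ Module.annihilator R A) : IsMinimax R (Ext.{u} (ModuleCat.of R A) Y i) := by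
  -- Dimension shifting: `A` is a quotient of some `(R/I)^m`, and the kernel is again finitely
  -- generated and killed by `I`.
  have killed (i : ℕ) (hi : i ≤ n)
      (ih : ∀ j, j + 1 = i → ∀ (B : Type u) [AddCommGroup B] [Module R B] [Module.Finite R B],
        I ≤ Module.annihilator R B → IsMinimax R (Ext.{u} (ModuleCat.of R B) Y j))
      (A : Type u) [AddCommGroup A] [Module R A] [Module.Finite R A]
      (hA : I ≤ Module.annihilator R A) : IsMinimax R (Ext.{u} (ModuleCat.of R A) Y i) := by
    obtain ⟨m, q, hq⟩ := exists_surjective_pi_quotient_of_le_annihilator hA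
    have hS := LinearMap.shortExact_shortComplexKer hq
    cases i with
    | zero =>
      exact isMinimax_ext_X₃_zero_of_contravariant hS Y (isMinimax_ext_pi _ Y (h 0 hi) m)
    | succ j =>
      refine isMinimax_ext_X₃_succ_of_contravariant hS Y (ih j rfl _ fun r hr ↦ ?_)
        (isMinimax_ext_pi _ Y (h _ hi) m)
      rw [Module.mem_annihilator]
      rintro ⟨x, _⟩
      ext j
      simp only [Submodule.coe_smul, Pi.smul_apply, ZeroMemClass.coe_zero, Pi.zero_apply]
      obtain ⟨y, hy⟩ := Ideal.Quotient.mk_surjective (x j)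
      rw [← hy, Algebra.smul_def, Ideal.Quotient.algebraMap_eq,
        Ideal.Quotient.eq_zero_iff_mem.mpr hr, zero_mul]
  have killed' (i : ℕ) : i ≤ n → ∀ (A : Type u) [AddCommGroup A] [Module R A] [Module.Finite R A],
      I ≤ Module.annihilator R A → IsMinimax R (Ext.{u} (ModuleCat.of R A) Y i) := by
    induction i with
    | zero => exact fun hi ↦ killed 0 hi (fun j hj ↦ by lia)
    | succ i ih =>
      refine fun hi ↦ killed (i + 1) hi (fun j hj ↦ ?_)
      obtain rfl : j = i := by lia
      exact ih (by lia)
  induction k generalizing A with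
  | zero => exact killed' i hi A (le_trans (by simp) hA)
  | succ k ih =>
    -- `IA` is killed by `I^k` and `A/IA` by `I`.
    let N : Submodule R A := I • ⊤
    refine isMinimax_ext_X₂_of_contravariant (shortExact_mkQ N) Y (ih N fun r hr ↦ ?_)
      (killed' i hi (A ⧸ N) fun r hr ↦ ?_)
    · rw [Module.mem_annihilator]
      rintro ⟨x, hx⟩
      refine Subtype.ext ?_
      have : N ≤ LinearMap.ker (LinearMap.lsmul R A r) := by
        refine Submodule.smul_le.mpr fun s hs y _ ↦ ?_
        have := Module.mem_annihilator.mp (hA (pow_succ I k ▸ Ideal.mul_mem_mul hr hs)) y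
        simpa [mul_smul, smul_comm s r y] using this
      simpa using this hx
    · rw [Module.mem_annihilator]
      intro x
      obtain ⟨x, rfl⟩ := N.mkQ_surjective x
      rw [← map_smul, Submodule.mkQ_apply, Submodule.Quotient.mk_eq_zero]
      exact Submodule.smul_mem_smul hr Submodule.mem_top

theorem isMinimax_ext_of_isMinimax (A : Type u) [AddCommGroup A] [Module R A] [Module.Finite R A]
    (L : Type u) [AddCommGroup L] [Module R L] (hL : IsMinimax R L) (i : ℕ) :
    IsMinimax R (Ext.{u} (ModuleCat.of R A) (ModuleCat.of R L) i) := by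
  -- For `I = 0` only `R/0 ≅ R` matters: it is projective, and evaluation at `1` embeds `Hom(R/0,
  -- L)` in `L`.
  refine isMinimax_ext_of_pow_le_annihilator ⊥ (ModuleCat.of R L) (n := i) (fun j _ ↦ ?_) i le_rfl
    A 1 (by simp)
  cases j with
  | zero =>
    let e := (Ext.linearEquiv₀ (R := R) (X := ModuleCat.of R (R ⧸ (⊥ : Ideal R)))
      (Y := ModuleCat.of R L)).trans ModuleCat.homLinearEquiv
    refine hL.of_injective (LinearMap.applyₗ (1 : R ⧸ (⊥ : Ideal R)) ∘ₗ e.toLinearMap) ?_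
    have h1 : Function.Injective
        (LinearMap.applyₗ (R := R) (M₂ := L) (1 : R ⧸ (⊥ : Ideal R))) := fun f g hfg ↦ by
      refine LinearMap.ext fun x ↦ ?_
      obtain ⟨r, rfl⟩ := Ideal.Quotient.mk_surjective x
      have hr : Ideal.Quotient.mk (⊥ : Ideal R) r = r • 1 := by
        rw [Algebra.smul_def, mul_one, Ideal.Quotient.algebraMap_eq]
      rw [hr, map_smul, map_smul]
      exact congrArg (r • ·) hfg
    exact h1.comp e.injective
  | succ j =>
    have : Module.Projective R (R ⧸ (⊥ : Ideal R)) :=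
      .of_equiv (Submodule.quotEquivOfEqBot (⊥ : Ideal R) rfl).symm
    have : Projective (ModuleCat.of R (R ⧸ (⊥ : Ideal R))) :=
      (IsProjective.iff_projective _).mp this
    have := Ext.subsingleton_of_projective (ModuleCat.of R (R ⧸ (⊥ : Ideal R)))
      (ModuleCat.of R L) j
    exact .of_subsingleton

end Ext

/-! ### Coefficient modules killed by an ideal. -/

section

variable {R : Type u} [CommRing R]

theorem ext_smul_eq_zero {X : ModuleCat.{u} R} {N : Type u} [AddCommGroup N] [Module R N] {i : ℕ}
    {x : R} (hx : x ∈ Module.annihilator R N) (e : Ext.{u} X (ModuleCat.of R N) i) :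
    x • e = 0 := by
  have h : x • 𝟙 (ModuleCat.of R N) = 0 := by
    ext y
    exact Module.mem_annihilator.mp hx y
  rw [Ext.smul_eq_comp_mk₀, h, Ext.mk₀_zero, Ext.comp_zero]

theorem le_annihilator_submodule {A : Type*} [AddCommGroup A] [Module R A] {I : Ideal R}
    (h : I ≤ Module.annihilator R A) (N : Submodule R A) : I ≤ Module.annihilator R N :=
  h.trans (N.subtype.annihilator_le_of_injective N.injective_subtype)

theorem le_annihilator_quotient {A : Type*} [AddCommGroup A] [Module R A] {I : Ideal R}
    (h : I ≤ Module.annihilator R A) (N : Submodule R A) : I ≤ Module.annihilator R (A ⧸ N) :=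
  h.trans (N.mkQ.annihilator_le_of_surjective N.mkQ_surjective)

variable [IsNoetherianRing R]

/-- For `x` annihilating `N`, multiplication by `x` on `A` factors through its image `xA`, and the
composite `Ext^i(A, N) → Ext^i(xA, N) → Ext^i(A, N)` vanishes. -/
theorem isMinimax_ext_of_isMinimax_ext_quotient_range {A N : Type u} [AddCommGroup A] [Module R A]
    [AddCommGroup N] [Module R N] {x : R} (hx : x ∈ Module.annihilator R N) {i : ℕ}
    (hker : ∀ j, j + 1 = i → IsMinimax R (Ext.{u}
      (ModuleCat.of R (LinearMap.ker (LinearMap.lsmul R A x))) (ModuleCat.of R N) j))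
    (hquot : IsMinimax R (Ext.{u}
      (ModuleCat.of R (A ⧸ LinearMap.range (LinearMap.lsmul R A x))) (ModuleCat.of R N) i)) :
    IsMinimax R (Ext.{u} (ModuleCat.of R A) (ModuleCat.of R N) i) := by
  let Y := ModuleCat.of R N
  let φ := LinearMap.lsmul R A x
  have hS₁ := shortExact_mkQ (LinearMap.range φ)
  have hS₂ : (ModuleCat.shortComplexOfCompEqZero (LinearMap.ker φ).subtype φ.rangeRestrict
      (by ext y; exact y.2)).ShortExact :=
    ModuleCat.shortComplex_shortExact _ (fun y ↦ by
      constructor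
      · intro hy
        exact ⟨⟨y, congrArg Subtype.val hy⟩, rfl⟩
      · rintro ⟨z, rfl⟩
        exact Subtype.ext z.2) (LinearMap.ker φ).injective_subtype φ.surjective_rangeRestrict
  let ι : ModuleCat.of R (LinearMap.range φ) ⟶ ModuleCat.of R A :=
    ModuleCat.ofHom (LinearMap.range φ).subtype
  let π : ModuleCat.of R A ⟶ ModuleCat.of R (LinearMap.range φ) :=
    ModuleCat.ofHom φ.rangeRestrict
  let f : Ext.{u} (ModuleCat.of R A) Y i →ₗ[R] Ext.{u} (ModuleCat.of R (LinearMap.range φ)) Y i :=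
    (Ext.mk₀ ι).precompOfLinear R Y (zero_add i)
  let g : Ext.{u} (ModuleCat.of R (LinearMap.range φ)) Y i →ₗ[R] Ext.{u} (ModuleCat.of R A) Y i :=
    (Ext.mk₀ π).precompOfLinear R Y (zero_add i)
  have hπι : π ≫ ι = x • 𝟙 (ModuleCat.of R A) := by
    ext y
    rfl
  have hgf (e) : f e ∈ LinearMap.ker g := by
    change (Ext.mk₀ π).comp ((Ext.mk₀ ι).comp e (zero_add i)) (zero_add i) = 0
    rw [Ext.mk₀_comp_mk₀_assoc, hπι, Ext.mk₀_smul, Ext.smul_comp, Ext.mk₀_id_comp,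
      ext_smul_eq_zero hx]
  -- This kernel is zero in degree `0`, and in degree `j + 1` it lies in the image of `Ext^j(ker φ,
  -- N)`.
  have hg : IsMinimax R (LinearMap.ker g) := by
    cases i with
    | zero =>
      have : Epi π := hS₂.epi_g
      have hinj : Function.Injective g := Ext.precomp_mk₀_injective_of_epi Y π
      rw [LinearMap.ker_eq_bot.mpr hinj]
      exact .of_subsingleton
    | succ j =>
      let δ : Ext.{u} (ModuleCat.of R (LinearMap.ker φ)) Y j →ₗ[R]
          Ext.{u} (ModuleCat.of R (LinearMap.range φ)) Y (j + 1) :=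
        hS₂.extClass.precompOfLinear R Y (add_comm 1 j)
      have hle : LinearMap.ker g ≤ LinearMap.range δ := fun e he ↦
        Ext.contravariant_sequence_exact₃ hS₂ Y e he (add_comm 1 j)
      exact ((hker j rfl).of_surjective δ.rangeRestrict δ.surjective_rangeRestrict).of_injective _
        (Submodule.inclusion_injective hle)
  exact hquot.of_exact hg ((Ext.mk₀ (ModuleCat.ofHom
    (LinearMap.range φ).mkQ)).precompOfLinear R Y (zero_add i)) (f.codRestrict _ hgf)
    fun e he ↦ Ext.contravariant_sequence_exact₂ hS₁ Y e (congrArg Subtype.val he)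

/-- Induction on the degree and, within it, on generators of `c`. If `A` is also killed by all of
`c`, it is killed by `a + c`. A generator `x` is then dropped from this requirement, since `A/xA` is
killed by `x` and the kernel of `x` on `A` enters only one degree lower. -/
theorem isMinimax_ext_of_le_annihilator_of_sup {a c : Ideal R} {N : Type u} [AddCommGroup N]
    [Module R N] (hc : c ≤ Module.annihilator R N)
    (h : ∀ i, IsMinimax R (Ext.{u} (ModuleCat.of R (R ⧸ (a ⊔ c))) (ModuleCat.of R N) i))
    (i : ℕ) (A : Type u) [AddCommGroup A] [Module R A] [Module.Finite R A]
    (hA : a ≤ Module.annihilator R A) :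
    IsMinimax R (Ext.{u} (ModuleCat.of R A) (ModuleCat.of R N) i) := by
  let Q (i : ℕ) (J : Ideal R) : Prop := ∀ (A : Type u) [AddCommGroup A] [Module R A]
    [Module.Finite R A], a ≤ Module.annihilator R A → J ≤ Module.annihilator R A →
      IsMinimax R (Ext.{u} (ModuleCat.of R A) (ModuleCat.of R N) i)
  have hQc (i : ℕ) : Q i c := fun A _ _ _ ha hc ↦
    isMinimax_ext_of_pow_le_annihilator (a ⊔ c) _ (fun j _ ↦ h j) i le_rfl A 1
      (by rw [pow_one]; exact sup_le ha hc)
  have step (i : ℕ) (hi : ∀ j, j + 1 = i → Q j ⊥) (K : Ideal R) :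
      K ≤ c → ∀ J, Q i (K ⊔ J) → Q i J := by
    induction K, IsNoetherian.noetherian K using Submodule.fg_induction with
    | singleton x =>
      intro hx J hQ A _ _ _ ha hJ
      refine isMinimax_ext_of_isMinimax_ext_quotient_range
        (hc (hx (Submodule.mem_span_singleton_self x)))
        (fun j hj ↦ hi j hj _ (le_annihilator_submodule ha _) bot_le)
        (hQ _ (le_annihilator_quotient ha _)
          (sup_le ?_ (le_annihilator_quotient hJ _)))
      rw [Submodule.span_singleton_le_iff_mem, Module.mem_annihilator]
      intro y
      obtain ⟨y, rfl⟩ := Submodule.mkQ_surjective _ y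
      rw [← map_smul, Submodule.mkQ_apply, Submodule.Quotient.mk_eq_zero]
      exact ⟨y, rfl⟩
    | sup K₁ K₂ _ _ h₁ h₂ =>
      intro hle J hQ
      refine h₂ (le_sup_right.trans hle) J (h₁ (le_sup_left.trans hle) _ ?_)
      rwa [← sup_assoc]
  have hQ (i : ℕ) : Q i ⊥ := by
    induction i with
    | zero => exact step 0 (fun j hj ↦ by lia) c le_rfl ⊥ (by simpa using hQc 0)
    | succ i ih =>
      refine step (i + 1) (fun j hj ↦ ?_) c le_rfl ⊥ (by simpa using hQc (i + 1))
      obtain rfl : j = i := by lia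
      exact ih
  exact hQ i A hA bot_le

end

/-! ### Transfer between the two ideals, and the conclusion. -/

theorem AdmitsP'.of_sup_annihilator_pow {R : Type u} [CommRing R] [IsNoetherianRing R] {n : ℕ}
    {a : Ideal R} (t : ℕ) (h : AdmitsP' n (a ⊔ Submodule.annihilator (a ^ t))) :
    AdmitsP' n a := by
  intro M _ _ hsupp hM
  set c := Submodule.annihilator (a ^ t)
  -- `φ` sends `y` to `x ↦ x • y`, so its kernel is `(0 :_M c)`.
  let φ : M →ₗ[R] (c →ₗ[R] M) := (LinearMap.lcomp R M c.subtype) ∘ₗ (LinearMap.lsmul R M).flip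
  let N := LinearMap.ker φ
  have hN : c ≤ Module.annihilator R N := fun x hx ↦ by
    rw [Module.mem_annihilator]
    exact fun y ↦ Subtype.ext (LinearMap.congr_fun y.2 ⟨x, hx⟩)
  have hcM : IsMinimax R (c →ₗ[R] M) := by
    refine isMinimax_linearMap_of_isMinimax_ext
      (isMinimax_ext_of_pow_le_annihilator a _ hM 0 (Nat.zero_le n) c t fun r hr ↦ ?_)
    rw [Module.mem_annihilator]
    rintro ⟨x, hx⟩
    refine Subtype.ext ?_
    rw [Submodule.mem_annihilator] at hx
    simpa [mul_comm] using hx r hr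
  have hMN : IsMinimax R (M ⧸ N) := hcM.of_injective (N.liftQ φ le_rfl) (by
    rw [← LinearMap.ker_eq_bot, Submodule.ker_liftQ_eq_bot]
    exact le_rfl)
  have hS := shortExact_mkQ N
  have hExtMN (i : ℕ) : IsMinimax R (ExtQuotient a (M ⧸ N) i) :=
    isMinimax_ext_of_isMinimax (R ⧸ a) (M ⧸ N) hMN i
  have hExtN : ∀ i ≤ n, IsMinimax R (ExtQuotient a N i) :=
    isMinimax_ext_X₁_of_covariant hS (ModuleCat.of R (R ⧸ a)) hM fun i _ ↦ hExtMN i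
  have hExtN' : ∀ i ≤ n, IsMinimax R (ExtQuotient (a ⊔ c) N i) := fun i hi ↦ by
    refine isMinimax_ext_of_pow_le_annihilator a _ hExtN i hi (R ⧸ (a ⊔ c)) 1 ?_
    rw [pow_one, Ideal.annihilator_quotient]
    exact le_sup_left
  have hsuppN : Module.support R N ⊆ PrimeSpectrum.zeroLocus ((a ⊔ c : Ideal R) : Set R) := by
    rw [PrimeSpectrum.zeroLocus_sup]
    refine Set.subset_inter
      ((Module.support_subset_of_injective N.subtype N.injective_subtype).trans hsupp) ?_
    exact fun p hp ↦ hN.trans (Module.annihilator_le_of_mem_support hp)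
  have hcomin := (h N hsuppN hExtN').2
  refine ⟨hsupp, fun i ↦ isMinimax_ext_X₂_of_covariant hS (ModuleCat.of R (R ⧸ a)) ?_ (hExtMN i)⟩
  exact isMinimax_ext_of_le_annihilator_of_sup hN hcomin i (R ⧸ a)
    (by rw [Ideal.annihilator_quotient])

theorem theorem3p2 {R : Type u} [CommRing R] [IsNoetherianRing R] (d : ℕ) (hd : 1 ≤ d)
    (hdim : ringKrullDim R = d)
    (h : ∀ a : Ideal R, ringKrullDim (R ⧸ a) ≤ ((d - 1 : ℕ) : WithBot ℕ∞) →
      AdmitsP' (d - 1) a) :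
    ∀ a : Ideal R, AdmitsP' (d - 1) a := by
  intro a
  obtain ⟨t, ht⟩ := exists_forall_annihilator_pow_le a
  refine .of_sup_annihilator_pow t (h _ ?_)
  have key := ringKrullDim_quotient_succ_le_of_forall_minimalPrimes
    (a ⊔ Submodule.annihilator (a ^ t)) fun p hp hle ↦ by
      obtain ⟨k, s, hs, hsp⟩ :=
        exists_notMem_annihilator_pow_of_mem_minimalPrimes hp (le_sup_left.trans hle)
      exact hsp (hle (Ideal.mem_sup_right (ht k hs)))
  -- Here `1 ≤ d` makes the truncated `d - 1` a true predecessor.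
  obtain ⟨d, rfl⟩ : ∃ e, d = e + 1 := ⟨d - 1, by lia⟩
  rw [hdim, Nat.cast_add, Nat.cast_one] at key
  rw [Nat.add_sub_cancel]
  exact ENat.WithBot.add_le_add_one_right_iff.mp key
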